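/- **Setting.** Let $T$ be a rigidly-compactly generated tensor triangulated category: a compactly generated triangulated category (with all set-indexed coproducts) with a symmetric monoidal structure $(\otimes,\mathbf 1)$ that is exact and coproduct-preserving in each variable, such that the full subcategory $T^c$ of compact objects contains $\mathbf 1$, is closed under $\otimes$, and is rigid (each compact object has a dual that is compact). Let $\operatorname{Spc}T^c$ be the set of prime (proper) thick tensor-ideals of $T^c$, with the Zariski topology, for which the sets $\operatorname{supp}k=\{P\mid k\notin P\}$, $k\in T^c$, form a basis of closed subsets; assume that $\operatorname{Spc}T^c$ is noetherian. Let $K$ be a compactly generated triangulated category with an action $*\colon T\times K\to K$, i.e. a functor, exact in each variable and distributing over set-indexed coproducts in each variable, with natural isomorphisms $(X\otimes Y)*A\cong X*(Y*A)$ and $\mathbf 1*A\cong A$ that are compatible with the exactness data and satisfy the usual associativity and unit coherence conditions, and such that for all $r,s\in\mathbb Z$ the two canonical isomorphisms $\Sigma^r\mathbf 1*\Sigma^sA\to\Sigma^{r+s}A$ differ by the sign $(-1)^{rs}$. For a specialisation closed subset $V\subseteq\operatorname{Spc}T^c$ let $\Gamma_V\mathbf 1\to\mathbf 1\to L_V\mathbf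 1\to\Sigma\Gamma_V\mathbf 1$ be the localisation triangle of $\mathbf 1$ with respect to the localising subcategory $\mathcal L_V$ generated by $\{t\in T^c\mid\operatorname{supp}t\subseteq V\}$; that is, $\Gamma_V\mathbf 1\in\mathcal L_V$ and $L_V\mathbf 1\in\mathcal L_V^{\perp}$. For $x\in\operatorname{Spc}T^c$ put $\mathcal V(x)=\overline{\{x\}}$, $\mathcal Z(x)=\{y\mid x\notin\overline{\{y\}}\}$ and $\Gamma_x\mathbf 1=\Gamma_{\mathcal V(x)}\mathbf 1\otimes L_{\mathcal Z(x)}\mathbf 1$. For $A\in K$ put $\Gamma_xA=\Gamma_x\mathbf 1*A$ and $\operatorname{supp}A=\{x\mid\Gamma_xA\neq0\}$, and let $\Gamma_xK$ be the essential image of $\Gamma_x\mathbf 1*(-)\colon K\to K$. A localising submodule of $K$ is a full replete triangulated subcategory closed under set-indexed coproducts and under the action of $T$; $\operatorname{loc}^*(S)$ is the smallest one containing $S$. For a localising submodule $L$ let $\sigma(L)=\{x\mid\Gamma_xA\neq0\text{ for some }A\in L\}$, and for $W\subseteq\operatorname{Spc}T^c$ let $\tau(W)$ be the localising submodule of all $A\in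 K$ with $\operatorname{supp}A\subseteq W$. **Proposition.** Assume the local-to-global principle holds for the action, i.e. $\operatorname{loc}^*(A)=\operatorname{loc}^*(\Gamma_xA\mid x\in\operatorname{Spc}T^c)$ for every $A\in K$. Then for every subset $W\subseteq\operatorname{Spc}T^c$ $$\sigma\tau(W)=W\cap\sigma K .$$ In particular, $\tau$ is injective when restricted to subsets of $\sigma K$. Moreover, for every $W\subseteq\operatorname{Spc}T^c$, $$\tau(W)=\operatorname{loc}^*(\Gamma_xK\mid x\in W\cap\sigma K).$$ -/

import Mathlib

open CategoryTheory Limits Pretriangulated MonoidalCategory ZeroObject Opposite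
open scoped CategoryTheory.MonoidalCategory.MonoidalLeftAction

universe v u u'

namespace TensorTriangular

/-! ### Triangulated categories with set-indexed coproducts

"Set" means "type in the universe `v` of the morphisms". Subcategories are full and replete and are
given by their objects, as terms of `ObjectProperty`. -/

section Triangulated

variable {C : Type u} [Category.{v} C] [Preadditive C]

/-- `t` is compact: the additive functor `C(t, -)` to abelian groups preserves set-indexed
coproducts. -/
def IsCompactObject : ObjectProperty C := fun t =>
  ∀ J : Type v, PreservesColimitsOfShape (Discrete J) (preadditiveCoyoneda.obj (op t))

variable [HasZeroObject C] [HasShift C ℤ] [∀ n : ℤ, (shiftFunctor C n).Additive]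
  [Pretriangulated C]

variable (C) in
/-- Compactly generated triangulated categories. -/
class CompactlyGenerated : Prop where
  hasCoproducts : HasCoproducts.{v} C
  exists_generators : ∃ (J : Type v) (G : J → C), (∀ j, IsCompactObject (G j)) ∧
    ∀ X : C, (∀ (j : J) (i : ℤ) (f : G j ⟶ X⟦i⟧), f = 0) → IsZero X

/-- Localising subcategories: replete triangulated subcategories closed under set-indexed
coproducts. -/
structure IsLocalising (P : ObjectProperty C) : Prop where
  isTriangulated : P.IsTriangulated
  isClosedUnderIsomorphisms : P.IsClosedUnderIsomorphisms
  coproduct (J : Type v) : P.IsClosedUnderColimitsOfShape (Discrete J)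

/-- Localising subcategories are stable under arbitrary intersections. -/
lemma isLocalising_forall {ι : Sort*} (P : ι → ObjectProperty C) (h : ∀ i, IsLocalising (P i)) :
    IsLocalising (fun X => ∀ i, P i X) := by
  have hz : ∀ i (Z : C), IsZero Z → P i Z := fun i Z hZ => by
    have := (h i).isTriangulated
    have := (h i).isClosedUnderIsomorphisms
    exact (P i).prop_of_isZero hZ
  have : ObjectProperty.IsClosedUnderIsomorphisms (fun X => ∀ i, P i X) :=
    ⟨fun e hX i => by
      have := (h i).isClosedUnderIsomorphisms
      exact (P i).prop_of_iso e (hX i)⟩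
  have : ObjectProperty.IsTriangulatedClosed₂ (fun X => ∀ i, P i X) :=
    .mk' fun D hD h₁ h₃ i => by
      have := (h i).isTriangulated
      have := (h i).isClosedUnderIsomorphisms
      exact (P i).ext_of_isTriangulatedClosed₂ D hD (h₁ i) (h₃ i)
  refine ⟨?_, inferInstance, fun J => ⟨?_⟩⟩
  · exact
      { exists_zero := ⟨0, isZero_zero C, fun i => hz i _ (isZero_zero C)⟩
        isStableUnderShiftBy := fun n => ⟨fun X hX i => by
          have := (h i).isTriangulated
          exact (P i).le_shift n X (hX i)⟩ }
  · rintro X ⟨p⟩ i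
    have := (h i).coproduct J
    exact (P i).colimitsOfShape_le (Discrete J) X ⟨⟨p.toColimitPresentation, fun j => p.prop_diag_obj j i⟩⟩

/-- The kernel of an exact coproduct-preserving functor is localising. -/
lemma isLocalising_kernel {D : Type u'} [Category.{v} D] [Preadditive D] [HasZeroObject D]
    [HasShift D ℤ] [∀ n : ℤ, (shiftFunctor D n).Additive] [Pretriangulated D] (F : C ⥤ D)
    [F.CommShift ℤ] [F.IsTriangulated]
    (hF : ∀ J : Type v, PreservesColimitsOfShape (Discrete J) F) :
    IsLocalising (fun X => IsZero (F.obj X)) := by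
  have : ObjectProperty.IsClosedUnderIsomorphisms (fun X : C => IsZero (F.obj X)) :=
    ⟨fun e hX => hX.of_iso (F.mapIso e.symm)⟩
  have : ObjectProperty.IsTriangulatedClosed₂ (fun X : C => IsZero (F.obj X)) :=
    .mk' fun D hD h₁ h₃ => (F.mapTriangle.obj D).isZero₂_of_isZero₁₃
      (F.map_distinguished D hD) h₁ h₃
  refine ⟨?_, inferInstance, fun J => ⟨?_⟩⟩
  · exact
      { exists_zero := ⟨0, isZero_zero C, F.map_isZero (isZero_zero C)⟩
        isStableUnderShiftBy := fun n => ⟨fun X hX =>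
          ((shiftFunctor D n).map_isZero hX).of_iso ((F.commShiftIso n).app X)⟩ }
  · rintro X ⟨p⟩
    have := hF J
    rw [IsZero.iff_id_eq_zero]
    exact (isColimitOfPreserves F p.isColimit).hom_ext fun j =>
      (p.prop_diag_obj j).eq_of_src _ _

/-- Thick subcategories: replete triangulated subcategories closed under direct summands. -/
structure IsThick (P : ObjectProperty C) : Prop where
  isTriangulated : P.IsTriangulated
  isClosedUnderIsomorphisms : P.IsClosedUnderIsomorphisms
  isStableUnderRetracts : P.IsStableUnderRetracts

/-- `loc S`, the smallest localising subcategory containing `S`. -/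
def loc (S : ObjectProperty C) : ObjectProperty C := fun X =>
  ∀ P : ObjectProperty C, IsLocalising P → S ≤ P → P X

/-- A localisation triangle `A ⟶ X ⟶ B ⟶ A⟦1⟧` of `X` for the subcategory `L`: the object `A` lies
in `L` and `B` lies in the right orthogonal of `L`. For `L` localising it is unique up to unique
isomorphism, `A` is the acyclisation and `B` the localisation of `X` with respect to `L`. -/
structure LocalisationTriangle (L : ObjectProperty C) (X : C) where
  acyclisation : C
  localisation : C
  mor₁ : acyclisation ⟶ X
  mor₂ : X ⟶ localisation
  mor₃ : localisation ⟶ acyclisation⟦(1 : ℤ)⟧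
  distinguished : Triangle.mk mor₁ mor₂ mor₃ ∈ distTriang C
  mem : L acyclisation
  mem_orthogonal : L.rightOrthogonal localisation

open Classical in
/-- The acyclisation of `X` with respect to `L`. It is used when `L` is generated by compact objects
of a compactly generated category; then a localisation triangle always exists, and the default value
`0` plays no role. -/
noncomputable def acyclisation (L : ObjectProperty C) (X : C) : C :=
  if h : Nonempty (LocalisationTriangle L X) then h.some.acyclisation else 0

open Classical in
/-- The localisation of `X` with respect to `L` (see `acyclisation` for the default value). -/
noncomputable def localisation (L : ObjectProperty C) (X : C) : C :=
  if h : Nonempty (LocalisationTriangle L X) then h.some.localisation else 0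

end Triangulated

/-! ### Rigidly-compactly generated tensor triangulated categories and their spectrum -/

section Tensor

variable (T : Type u) [Category.{v} T] [Preadditive T] [HasZeroObject T] [HasShift T ℤ]
  [∀ n : ℤ, (shiftFunctor T n).Additive] [Pretriangulated T]
  [MonoidalCategory T] [SymmetricCategory T]

/-- The tensor product is exact in each variable. -/
class TensorTriangulated where
  commShiftTensorLeft (X : T) : (tensorLeft X).CommShift ℤ
  commShiftTensorRight (X : T) : (tensorRight X).CommShift ℤ
  isTriangulated_tensorLeft (X : T) : (tensorLeft X).IsTriangulated
  isTriangulated_tensorRight (X : T) : (tensorRight X).IsTriangulated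

attribute [reducible, instance] TensorTriangulated.commShiftTensorLeft
  TensorTriangulated.commShiftTensorRight
attribute [instance] TensorTriangulated.isTriangulated_tensorLeft
  TensorTriangulated.isTriangulated_tensorRight

/-- Rigidly-compactly generated tensor triangulated categories. Rigidity of the tensor subcategory
of compact objects is expressed by saying that each of its objects has a dual in it. -/
class RigidlyCompactlyGenerated [TensorTriangulated T] : Prop extends CompactlyGenerated T where
  tensorLeft_coproduct (X : T) (J : Type v) :
    PreservesColimitsOfShape (Discrete J) (tensorLeft X)
  tensorRight_coproduct (X : T) (J : Type v) :
    PreservesColimitsOfShape (Discrete J) (tensorRight X)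
  compact_unit : IsCompactObject (𝟙_ T)
  compact_tensor (s t : T) : IsCompactObject s → IsCompactObject t → IsCompactObject (s ⊗ t)
  exists_dual (t : T) : IsCompactObject t →
    ∃ t' : T, IsCompactObject t' ∧ Nonempty (ExactPairing t t')

/-- The spectrum of the category of compact objects of `T`: its points are the prime ideals, that
is, the proper thick tensor-ideals of the subcategory of compact objects which are prime. -/
@[ext]
structure Spc where
  carrier : ObjectProperty T
  le_compact : carrier ≤ IsCompactObject
  isThick : IsThick carrier
  tensor_mem (k l : T) : IsCompactObject k → carrier l → carrier (k ⊗ l)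
  proper : ∃ k : T, IsCompactObject k ∧ ¬ carrier k
  mem_or_mem (k l : T) : IsCompactObject k → IsCompactObject l → carrier (k ⊗ l) →
    carrier k ∨ carrier l

/-- The Zariski topology: the supports `{P | k ∉ P}` of the compact objects `k` are a basis of
closed subsets, i.e. their complements `{P | k ∈ P}` are a basis of open subsets. -/
instance : TopologicalSpace (Spc T) :=
  TopologicalSpace.generateFrom {U | ∃ k : T, IsCompactObject k ∧ U = {P : Spc T | P.carrier k}}

variable {T}

/-- The support of a compact object. -/
def suppCompact (k : T) : Set (Spc T) := {P | ¬ P.carrier k}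

/-- The thick tensor-ideal of compact objects with support in `V`. -/
def compactsSupportedIn (V : Set (Spc T)) : ObjectProperty T := fun t =>
  IsCompactObject t ∧ suppCompact t ⊆ V

/-- The tensor-idempotent `Γ_V 𝟙`: the acyclisation of the unit with respect to the localising
subcategory generated by the compact objects with support in `V`. -/
noncomputable def gammaUnit (V : Set (Spc T)) : T := acyclisation (loc (compactsSupportedIn V)) (𝟙_ T)

/-- The tensor-idempotent `L_V 𝟙`. -/
noncomputable def ellUnit (V : Set (Spc T)) : T := localisation (loc (compactsSupportedIn V)) (𝟙_ T)

/-- `𝒱(x)`, the closure of `x`. -/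
def vSet (x : Spc T) : Set (Spc T) := closure {x}

/-- `𝒵(x)`, the set of the points `y` such that `x` is not in the closure of `y`. -/
def zSet (x : Spc T) : Set (Spc T) := {y | x ∉ vSet y}

/-- `Γ_x 𝟙 = Γ_{𝒱(x)} 𝟙 ⊗ L_{𝒵(x)} 𝟙`. -/
noncomputable def pointUnit (x : Spc T) : T := gammaUnit (vSet x) ⊗ ellUnit (zSet x)

end Tensor

/-! ### Actions -/

section Action

variable (T : Type u) [Category.{v} T] [Preadditive T] [HasZeroObject T] [HasShift T ℤ]
  [∀ n : ℤ, (shiftFunctor T n).Additive] [Pretriangulated T]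
  [MonoidalCategory T] [SymmetricCategory T] [TensorTriangulated T]
  (K : Type u') [Category.{v} K] [Preadditive K] [HasZeroObject K] [HasShift K ℤ]
  [∀ n : ℤ, (shiftFunctor K n).Additive] [Pretriangulated K] [MonoidalLeftAction T K]

/-- A bifunctor `T × K ⥤ K` with coherent associator and unitor (a `MonoidalLeftAction`) is an
action of the tensor triangulated category `T` on `K` if it is exact in each variable, the associator
and the unitor are compatible with the exactness data, and it distributes over coproducts. -/
class TriangulatedAction where
  /-- The isomorphisms `X * A⟦n⟧ ≅ (X * A)⟦n⟧`. -/
  commShiftActionLeft (X : T) : (MonoidalLeftAction.actionLeft K X).CommShift ℤ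
  /-- The isomorphisms `X⟦n⟧ * A ≅ (X * A)⟦n⟧`. -/
  commShiftActionRight (A : K) : (MonoidalLeftAction.actionRight T A).CommShift ℤ
  isTriangulated_actionLeft (X : T) : (MonoidalLeftAction.actionLeft K X).IsTriangulated
  isTriangulated_actionRight (A : K) : (MonoidalLeftAction.actionRight T A).IsTriangulated
  /-- The associator is compatible with shifts of the first argument. -/
  assoc_shift₁ (X Y : T) (A : K) (n : ℤ) :
    (αₗ (X⟦n⟧) Y A).hom ≫
        ((MonoidalLeftAction.actionRight T (Y ⊙ₗ A)).commShiftIso n).hom.app X =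
      (((tensorRight Y).commShiftIso n).hom.app X ⊵ₗ A) ≫
        ((MonoidalLeftAction.actionRight T A).commShiftIso n).hom.app (X ⊗ Y) ≫
          (αₗ X Y A).hom⟦n⟧'
  /-- The associator is compatible with shifts of the second argument. -/
  assoc_shift₂ (X Y : T) (A : K) (n : ℤ) :
    (αₗ X (Y⟦n⟧) A).hom ≫
        (X ⊴ₗ ((MonoidalLeftAction.actionRight T A).commShiftIso n).hom.app Y) ≫
          ((MonoidalLeftAction.actionLeft K X).commShiftIso n).hom.app (Y ⊙ₗ A) =
      (((tensorLeft X).commShiftIso n).hom.app Y ⊵ₗ A) ≫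
        ((MonoidalLeftAction.actionRight T A).commShiftIso n).hom.app (X ⊗ Y) ≫
          (αₗ X Y A).hom⟦n⟧'
  /-- The associator is compatible with shifts of the third argument. -/
  assoc_shift₃ (X Y : T) (A : K) (n : ℤ) :
    (αₗ X Y (A⟦n⟧)).hom ≫
        (X ⊴ₗ ((MonoidalLeftAction.actionLeft K Y).commShiftIso n).hom.app A) ≫
          ((MonoidalLeftAction.actionLeft K X).commShiftIso n).hom.app (Y ⊙ₗ A) =
      ((MonoidalLeftAction.actionLeft K (X ⊗ Y)).commShiftIso n).hom.app A ≫
        (αₗ X Y A).hom⟦n⟧'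
  /-- The unitor is compatible with shifts. -/
  unit_shift (A : K) (n : ℤ) :
    (λₗ[T] (A⟦n⟧)).hom =
      ((MonoidalLeftAction.actionLeft K (𝟙_ T)).commShiftIso n).hom.app A ≫ (λₗ[T] A).hom⟦n⟧'
  /-- The two maps from `𝟙⟦r⟧ * A⟦s⟧` to `A⟦r + s⟧` agree up to the sign `(-1) ^ (r * s)`. -/
  sign (A : K) (r s : ℤ) :
    (r * s).negOnePow •
        (((MonoidalLeftAction.actionLeft K ((𝟙_ T)⟦r⟧)).commShiftIso s).hom.app A ≫
          (((MonoidalLeftAction.actionRight T A).commShiftIso r).hom.app (𝟙_ T))⟦s⟧' ≫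
            (λₗ[T] A).hom⟦r⟧'⟦s⟧' ≫ (shiftFunctorAdd' K r s (r + s) rfl).inv.app A) =
      ((MonoidalLeftAction.actionRight T (A⟦s⟧)).commShiftIso r).hom.app (𝟙_ T) ≫
        (λₗ[T] (A⟦s⟧)).hom⟦r⟧' ≫ (shiftFunctorAdd' K s r (r + s) (add_comm s r)).inv.app A
  actionLeft_coproduct (X : T) (J : Type v) :
    PreservesColimitsOfShape (Discrete J) (MonoidalLeftAction.actionLeft K X)
  actionRight_coproduct (A : K) (J : Type v) :
    PreservesColimitsOfShape (Discrete J) (MonoidalLeftAction.actionRight T A)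

attribute [reducible, instance] TriangulatedAction.commShiftActionLeft
  TriangulatedAction.commShiftActionRight
attribute [instance] TriangulatedAction.isTriangulated_actionLeft
  TriangulatedAction.isTriangulated_actionRight TriangulatedAction.actionLeft_coproduct
  TriangulatedAction.actionRight_coproduct

/-- Localising `T`-submodules of `K`. -/
@[ext]
structure LocalisingSubmodule where
  carrier : ObjectProperty K
  isLocalising : IsLocalising carrier
  action_mem (X : T) (A : K) : carrier A → carrier (X ⊙ₗ A)

variable {T K}

/-- The support of an object of `K`, the set of the points `x` with `Γ_x A = Γ_x 𝟙 * A ≠ 0`. -/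
def supp (A : K) : Set (Spc T) := {x | ¬ IsZero (pointUnit x ⊙ₗ A)}

/-- `Γ_x K`, the essential image of `Γ_x 𝟙 * -`. -/
def gammaEssImage (K : Type u') [Category.{v} K] [MonoidalLeftAction T K] (x : Spc T) :
    ObjectProperty K :=
  (MonoidalLeftAction.actionLeft K (pointUnit x)).essImage

variable (T K) in
/-- `K` as a submodule of itself. -/
def wholeSubmodule : LocalisingSubmodule T K where
  carrier := ⊤
  isLocalising :=
    { isTriangulated :=
        { exists_zero := ⟨0, isZero_zero K, trivial⟩
          isStableUnderShiftBy := fun _ => ⟨fun _ _ => trivial⟩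
          ext₂' := fun _ _ _ _ => ObjectProperty.le_isoClosure _ _ trivial }
      isClosedUnderIsomorphisms := inferInstance
      coproduct := fun _ => inferInstance }
  action_mem _ _ _ := trivial

variable (T) in
/-- `loc^* S`, the smallest localising `T`-submodule containing `S`. -/
def locStar (S : ObjectProperty K) : LocalisingSubmodule T K where
  carrier := fun A => ∀ M : LocalisingSubmodule T K, S ≤ M.carrier → M.carrier A
  isLocalising := isLocalising_forall _ fun M =>
    isLocalising_forall _ fun _ => M.isLocalising
  action_mem X A hA M hM := M.action_mem X A (hA M hM)

/-- `σ L = {x | Γ_x L ≠ 0}`. -/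
def sigma (L : LocalisingSubmodule T K) : Set (Spc T) :=
  {x | ∃ A, L.carrier A ∧ ¬ IsZero (pointUnit x ⊙ₗ A)}

variable [TriangulatedAction T K]

variable (K) in
/-- `τ W`, the localising submodule of the objects with support in `W`. -/
def tau (W : Set (Spc T)) : LocalisingSubmodule T K where
  carrier := fun A => supp A ⊆ W
  isLocalising := by
    have h := isLocalising_forall _ fun x : {x : Spc T // x ∉ W} =>
      isLocalising_kernel (MonoidalLeftAction.actionLeft K (pointUnit x.1)) fun _ => inferInstance
    convert h using 2 with A
    exact ⟨fun hA x => by_contra fun hx => x.2 (hA hx),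
      fun hA x hx => by_contra fun hW => hx (hA ⟨x, hW⟩)⟩
  action_mem X A hA x hx := hA fun h => hx <|
    (((MonoidalLeftAction.actionLeft K X).map_isZero h).of_iso <|
      (αₗ (pointUnit x) X A).symm ≪≫
        (MonoidalLeftAction.actionRight T A).mapIso (β_ (pointUnit x) X) ≪≫
          αₗ X (pointUnit x) A)

variable (T K) in
/-- The local-to-global principle: `loc^*(A) = loc^*(Γ_x A | x ∈ Spc)` for every object `A`. -/
def LocalToGlobal : Prop :=
  ∀ A : K, locStar T (ObjectProperty.singleton A) =
    locStar T (ObjectProperty.ofObj fun x : Spc T => pointUnit x ⊙ₗ A)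

end Action

end TensorTriangular

/-!
Tensoring with the idempotents `Γ_x 𝟙` separates the points of the spectrum, and this is all that
the local-to-global principle needs to become the stated description of `τ`.

The main point is that `Y ⊗ L_V 𝟙 = 0` for every `Y` in the localising subcategory `ℒ_V` generated
by the compact objects supported in `V` (`isZero_tensor_ellUnit`). As the kernel of `- ⊗ L_V 𝟙` is
localising, it suffices to treat a compact `Y = t` supported in `V`. Its dual `t'` is a retract of
`t' ⊗ (t ⊗ t')`, so `t' ⊗ s` is again supported in `V` for every compact `s`; hence
`Hom(s, t ⊗ L_V 𝟙⟦i⟧) ≃ Hom(t' ⊗ s, L_V 𝟙⟦i⟧) = 0`, and `t ⊗ L_V 𝟙` vanishes by compact generation.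

Consequently `Γ_V 𝟙 ⊗ L_V 𝟙 = 0`, so tensoring the localisation triangle with either of its ends
shows that `Γ_V 𝟙` and `L_V 𝟙` are tensor-idempotent, and so is `Γ_x 𝟙` (`nonempty_pointUnit_tensor_self_iso`).
If `V ⊆ W`, then `Γ_V 𝟙 ∈ ℒ_V ⊆ ℒ_W` and so `Γ_V 𝟙 ⊗ L_W 𝟙 = 0`. For distinct points one of them,
say `y`, lies outside the closure of the other, because the spectrum is `T₀`; then
`𝒱(x) ⊆ 𝒵(y)` and `Γ_x 𝟙 ⊗ Γ_y 𝟙 = 0` (`isZero_pointUnit_tensor_pointUnit`).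

Hence `Γ_x A` has support `{x}` if it is nonzero. This gives `x ∈ σ τ W` for all `x ∈ W ∩ σ K`, and
it shows that `τ W` contains `Γ_x K` for these `x`. Conversely the local-to-global principle puts
every `A ∈ τ W` into the submodule generated by the `Γ_x A`, and each of these is zero
unless `x ∈ supp A ⊆ W`.
-/

set_option linter.unusedSectionVars false

namespace TensorTriangular

/-! ### Localising subcategories and localisation triangles -/

section Localising

variable {C : Type u} [Category.{v} C] [Preadditive C] [HasZeroObject C] [HasShift C ℤ]
  [∀ n : ℤ, (shiftFunctor C n).Additive] [Pretriangulated C]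

lemma isLocalising_loc (S : ObjectProperty C) : IsLocalising (loc S) :=
  isLocalising_forall _ fun _ => isLocalising_forall _ fun h => isLocalising_forall _ fun _ => h

lemma le_loc (S : ObjectProperty C) : S ≤ loc S := fun _ hX _ _ hS => hS _ hX

lemma loc_mono {S S' : ObjectProperty C} (h : S ≤ S') : loc S ≤ loc S' :=
  fun _ hX P hP hS => hX P hP (h.trans hS)

lemma IsLocalising.prop_of_isZero {P : ObjectProperty C} (hP : IsLocalising P) {X : C}
    (hX : IsZero X) : P X := by
  have := hP.isTriangulated
  have := hP.isClosedUnderIsomorphisms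
  exact P.prop_of_isZero hX

lemma acyclisation_mem {L : ObjectProperty C} (hL : IsLocalising L) (X : C) :
    L (acyclisation L X) := by
  unfold acyclisation
  split_ifs with h
  · exact h.some.mem
  · exact hL.prop_of_isZero (isZero_zero C)

lemma localisation_mem_rightOrthogonal (L : ObjectProperty C) (X : C) :
    L.rightOrthogonal (localisation L X) := by
  unfold localisation
  split_ifs with h
  · exact h.some.mem_orthogonal
  · exact fun _ f _ => (isZero_zero C).eq_of_tgt _ _

/-- The second alternative covers the default values of `acyclisation` and `localisation`. The
existence of localisation triangles is not needed, as the results below about tensor products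
of these objects hold for zero objects as well. -/
lemma exists_distinguished_or_isZero (L : ObjectProperty C) (X : C) :
    (∃ (f : acyclisation L X ⟶ X) (g : X ⟶ localisation L X)
      (h : localisation L X ⟶ (acyclisation L X)⟦(1 : ℤ)⟧), Triangle.mk f g h ∈ distTriang C) ∨
    (IsZero (acyclisation L X) ∧ IsZero (localisation L X)) := by
  by_cases h : Nonempty (LocalisationTriangle L X)
  · rw [show acyclisation L X = _ from dif_pos h, show localisation L X = _ from dif_pos h]
    exact Or.inl ⟨h.some.mor₁, h.some.mor₂, h.some.mor₃, h.some.distinguished⟩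
  · rw [show acyclisation L X = _ from dif_neg h, show localisation L X = _ from dif_neg h]
    exact Or.inr ⟨isZero_zero C, isZero_zero C⟩

end Localising

/-! ### Supports and duals of compact objects -/

section Compact

variable {T : Type u} [Category.{v} T] [Preadditive T] [HasZeroObject T] [HasShift T ℤ]
  [∀ n : ℤ, (shiftFunctor T n).Additive] [Pretriangulated T]
  [MonoidalCategory T] [SymmetricCategory T]

instance : T0Space (Spc T) := by
  refine ⟨fun x y h => ?_⟩
  have key : ∀ k, IsCompactObject k → (x.carrier k ↔ y.carrier k) := fun k hk =>
    h.mem_open_iff (s := {P : Spc T | P.carrier k})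
      (TopologicalSpace.isOpen_generateFrom_of_mem ⟨k, hk, rfl⟩)
  ext k
  exact ⟨fun hx => (key k (x.le_compact k hx)).1 hx, fun hy => (key k (y.le_compact k hy)).2 hy⟩

lemma Spc.prop_of_iso (P : Spc T) {k l : T} (e : k ≅ l) (hk : P.carrier k) : P.carrier l := by
  have := P.isThick.isClosedUnderIsomorphisms
  exact P.carrier.prop_of_iso e hk

/-- A dual `t'` of `t` is a retract of `t' ⊗ (t ⊗ t')`, by one of the triangle identities. -/
def retractTensorOfExactPairing (t t' : T) [ExactPairing t t'] : Retract t' (t' ⊗ (t ⊗ t')) where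
  i := (ρ_ t').inv ≫ t' ◁ η_ t t'
  r := (α_ t' t t').inv ≫ ε_ t t' ▷ t' ≫ (λ_ t').hom
  retract := by
    simp only [Category.assoc]
    rw [ExactPairing.coevaluation_evaluation_assoc]
    simp

lemma Spc.dual_mem (P : Spc T) {t t' : T} [ExactPairing t t'] (ht' : IsCompactObject t')
    (ht : P.carrier t) : P.carrier t' := by
  have := P.isThick.isStableUnderRetracts
  exact P.carrier.prop_of_retract (retractTensorOfExactPairing t t') <|
    P.tensor_mem _ _ ht' <| P.prop_of_iso (β_ t' t) <| P.tensor_mem _ _ ht' ht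

variable [TensorTriangulated T] [RigidlyCompactlyGenerated T]

lemma compactsSupportedIn_dual_tensor {V : Set (Spc T)} {t t' s : T} [ExactPairing t t']
    (ht : compactsSupportedIn V t) (ht' : IsCompactObject t') (hs : IsCompactObject s) :
    compactsSupportedIn V (t' ⊗ s) :=
  ⟨RigidlyCompactlyGenerated.compact_tensor _ _ ht' hs, fun P hP => ht.2 fun h =>
    hP <| P.prop_of_iso (β_ s t') <| P.tensor_mem _ _ hs <| P.dual_mem ht' h⟩

/-! ### The idempotents attached to subsets and points of the spectrum -/

lemma isZero_tensor_ellUnit_of_compact {V : Set (Spc T)} {t : T} (ht : compactsSupportedIn V t) :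
    IsZero (t ⊗ ellUnit V) := by
  obtain ⟨J, G, hG, h⟩ := CompactlyGenerated.exists_generators (C := T)
  obtain ⟨t', ht', ⟨_⟩⟩ := RigidlyCompactlyGenerated.exists_dual t ht.1
  have := (isLocalising_loc (compactsSupportedIn V)).isTriangulated
  refine h _ fun j i f => ?_
  have hL : (loc (compactsSupportedIn V)).rightOrthogonal ((ellUnit V)⟦i⟧) :=
    ObjectProperty.le_shift _ i _ (localisation_mem_rightOrthogonal _ _)
  let e : t ⊗ (ellUnit V)⟦i⟧ ≅ (t ⊗ ellUnit V)⟦i⟧ :=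
    ((tensorLeft t).commShiftIso i).app (ellUnit V)
  rw [← cancel_mono e.inv, zero_comp]
  refine (tensorLeftHomEquiv (G j) t t' ((ellUnit V)⟦i⟧)).symm.injective ?_
  have hs : loc (compactsSupportedIn V) (t' ⊗ G j) :=
    le_loc _ _ (compactsSupportedIn_dual_tensor ht ht' (hG j))
  exact (hL _ hs).trans (hL _ hs).symm

/-- The localising subcategory generated by the compact objects supported in `V` is annihilated by
`L_V 𝟙`. -/
lemma isZero_tensor_ellUnit {V : Set (Spc T)} {Y : T} (hY : loc (compactsSupportedIn V) Y) :
    IsZero (Y ⊗ ellUnit V) :=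
  hY _ (isLocalising_kernel (tensorRight (ellUnit V))
    (RigidlyCompactlyGenerated.tensorRight_coproduct _)) fun _ => isZero_tensor_ellUnit_of_compact

lemma isZero_gammaUnit_tensor_ellUnit {V W : Set (Spc T)} (h : V ⊆ W) :
    IsZero (gammaUnit V ⊗ ellUnit W) :=
  isZero_tensor_ellUnit <| loc_mono (fun _ ht => ⟨ht.1, ht.2.trans h⟩) _ <|
    acyclisation_mem (isLocalising_loc _) _

lemma isZero_tensor_left (X : T) {Y : T} (hY : IsZero Y) : IsZero (X ⊗ Y) :=
  (tensorLeft X).map_isZero hY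

lemma isZero_tensor_right {X : T} (hX : IsZero X) (Y : T) : IsZero (X ⊗ Y) :=
  (tensorRight Y).map_isZero hX

/-- Tensoring the localisation triangle with `Γ_V 𝟙` annihilates its third vertex. -/
lemma nonempty_gammaUnit_tensor_self_iso (V : Set (Spc T)) :
    Nonempty (gammaUnit V ⊗ gammaUnit V ≅ gammaUnit V) := by
  rcases exists_distinguished_or_isZero (loc (compactsSupportedIn V)) (𝟙_ T) with
    ⟨f, g, h, hT⟩ | ⟨hΓ, -⟩
  · have hT' := (tensorLeft (gammaUnit V)).map_distinguished _ hT
    have : IsIso (gammaUnit V ◁ f) :=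
      (Triangle.isZero₃_iff_isIso₁ _ hT').1 (isZero_gammaUnit_tensor_ellUnit subset_rfl)
    exact ⟨@asIso _ _ _ _ (gammaUnit V ◁ f) this ≪≫ ρ_ _⟩
  · exact ⟨(isZero_tensor_left _ hΓ).iso hΓ⟩

/-- Tensoring the localisation triangle with `L_V 𝟙` annihilates its first vertex. -/
lemma nonempty_ellUnit_tensor_self_iso (V : Set (Spc T)) :
    Nonempty (ellUnit V ⊗ ellUnit V ≅ ellUnit V) := by
  rcases exists_distinguished_or_isZero (loc (compactsSupportedIn V)) (𝟙_ T) with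
    ⟨f, g, h, hT⟩ | ⟨-, hL⟩
  · have hT' := (tensorRight (ellUnit V)).map_distinguished _ hT
    have : IsIso (g ▷ ellUnit V) :=
      (Triangle.isZero₁_iff_isIso₂ _ hT').1 (isZero_gammaUnit_tensor_ellUnit subset_rfl)
    exact ⟨(@asIso _ _ _ _ (g ▷ ellUnit V) this).symm ≪≫ λ_ _⟩
  · exact ⟨(isZero_tensor_left _ hL).iso hL⟩

/-- The middle two factors interchanged, `tensorμ` as an isomorphism. -/
def tensorTensorTensorComm (X Y Z W : T) : (X ⊗ Y) ⊗ (Z ⊗ W) ≅ (X ⊗ Z) ⊗ (Y ⊗ W) where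
  hom := tensorμ X Y Z W
  inv := tensorδ X Y Z W

lemma nonempty_pointUnit_tensor_self_iso (x : Spc T) :
    Nonempty (pointUnit x ⊗ pointUnit x ≅ pointUnit x) := by
  obtain ⟨a⟩ := nonempty_gammaUnit_tensor_self_iso (vSet x)
  obtain ⟨b⟩ := nonempty_ellUnit_tensor_self_iso (zSet x)
  exact ⟨tensorTensorTensorComm _ _ _ _ ≪≫ (a ⊗ᵢ b)⟩

lemma isZero_pointUnit_tensor_pointUnit_of_notMem {x y : Spc T} (h : y ∉ vSet x) :
    IsZero (pointUnit x ⊗ pointUnit y) := by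
  have hxy : vSet x ⊆ zSet y := fun z hz hy =>
    h (closure_minimal (Set.singleton_subset_iff.2 hz) isClosed_closure hy)
  -- Move `L_{𝒵(y)} 𝟙` next to `Γ_{𝒱(x)} 𝟙`.
  exact (isZero_tensor_right (isZero_gammaUnit_tensor_ellUnit hxy) _).of_iso <|
    whiskerLeftIso _ (β_ _ _) ≪≫ tensorTensorTensorComm _ _ _ _

lemma isZero_pointUnit_tensor_pointUnit {x y : Spc T} (h : x ≠ y) :
    IsZero (pointUnit x ⊗ pointUnit y) := by
  by_cases hy : y ∈ vSet x
  · have hx : x ∉ vSet y := fun hx => h <|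
      ((specializes_iff_mem_closure.2 hx).antisymm (specializes_iff_mem_closure.2 hy)).symm.eq
    exact (isZero_pointUnit_tensor_pointUnit_of_notMem hx).of_iso (β_ _ _)
  · exact isZero_pointUnit_tensor_pointUnit_of_notMem hy

end Compact

/-! ### Supports in a module category -/

section Action

variable {T : Type u} [Category.{v} T] [Preadditive T] [HasZeroObject T] [HasShift T ℤ]
  [∀ n : ℤ, (shiftFunctor T n).Additive] [Pretriangulated T]
  [MonoidalCategory T] [SymmetricCategory T] [TensorTriangulated T]
  {K : Type u'} [Category.{v} K] [Preadditive K] [HasZeroObject K] [HasShift K ℤ]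
  [∀ n : ℤ, (shiftFunctor K n).Additive] [Pretriangulated K] [MonoidalLeftAction T K]

lemma locStar_le {S : ObjectProperty K} {M : LocalisingSubmodule T K} (h : S ≤ M.carrier) :
    (locStar T S).carrier ≤ M.carrier :=
  fun _ hA => hA M h

lemma le_locStar (S : ObjectProperty K) : S ≤ (locStar T S).carrier :=
  fun _ hA _ hM => hM _ hA

lemma mem_sigma_wholeSubmodule {x : Spc T} :
    x ∈ sigma (wholeSubmodule T K) ↔ ∃ A : K, x ∈ supp A :=
  ⟨fun ⟨A, _, hA⟩ => ⟨A, hA⟩, fun ⟨A, hA⟩ => ⟨A, trivial, hA⟩⟩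

variable [TriangulatedAction T K]

lemma supp_congr {A B : K} (e : A ≅ B) : supp (T := T) A = supp B := by
  ext x
  exact not_congr ((MonoidalLeftAction.actionLeft K (pointUnit x)).mapIso e).isZero_iff

variable [RigidlyCompactlyGenerated T]

lemma supp_pointUnit_action_subset (x : Spc T) (A : K) :
    supp (pointUnit x ⊙ₗ A) ⊆ ({x} : Set (Spc T)) := fun y hy => by
  by_contra hxy
  exact hy <| ((MonoidalLeftAction.actionRight T A).map_isZero
    (isZero_pointUnit_tensor_pointUnit hxy)).of_iso (αₗ (pointUnit y) (pointUnit x) A).symm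

lemma mem_supp_pointUnit_action {x : Spc T} {A : K} (h : x ∈ supp A) :
    x ∈ supp (pointUnit x ⊙ₗ A) := fun h0 => by
  obtain ⟨e⟩ := nonempty_pointUnit_tensor_self_iso x
  exact h <| h0.of_iso <| ((MonoidalLeftAction.actionRight T A).mapIso e).symm ≪≫
    αₗ (pointUnit x) (pointUnit x) A

lemma gammaEssImage_le_tau {W : Set (Spc T)} {x : Spc T} (hx : x ∈ W) :
    gammaEssImage K x ≤ (tau K W).carrier := by
  rintro B ⟨A, ⟨e⟩⟩
  exact (supp_congr e).symm.subset.trans <|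
    (supp_pointUnit_action_subset x A).trans (Set.singleton_subset_iff.2 hx)

lemma sigma_tau (W : Set (Spc T)) :
    sigma (tau K W) = W ∩ sigma (wholeSubmodule T K) := by
  ext x
  rw [Set.mem_inter_iff, mem_sigma_wholeSubmodule]
  constructor
  · rintro ⟨A, hA, hx⟩
    exact ⟨hA hx, A, hx⟩
  · rintro ⟨hW, A, hx⟩
    exact ⟨pointUnit x ⊙ₗ A, gammaEssImage_le_tau hW _ (Functor.obj_mem_essImage _ A),
      mem_supp_pointUnit_action hx⟩

lemma tau_eq_locStar (hLTG : LocalToGlobal T K) (W : Set (Spc T)) :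
    tau K W = locStar T (⨆ x ∈ W ∩ sigma (wholeSubmodule T K), gammaEssImage K x) := by
  refine LocalisingSubmodule.ext (le_antisymm (fun A hA => ?_)
    (locStar_le (iSup₂_le fun x hx => gammaEssImage_le_tau hx.1)))
  have hA' : (locStar T (ObjectProperty.singleton A)).carrier A :=
    le_locStar _ _ (by simp)
  rw [hLTG A] at hA'
  refine locStar_le ?_ _ hA'
  rintro _ ⟨x⟩
  by_cases hx : x ∈ supp A
  · have hxW : x ∈ W ∩ sigma (wholeSubmodule T K) :=
      ⟨hA hx, mem_sigma_wholeSubmodule.2 ⟨A, hx⟩⟩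
    exact le_locStar _ _ <|
      le_iSup₂_of_le (f := fun x (_ : x ∈ W ∩ sigma (wholeSubmodule T K)) => gammaEssImage K x)
        x hxW le_rfl _ (Functor.obj_mem_essImage _ A)
  · exact (locStar T _).isLocalising.prop_of_isZero (not_not.1 hx)

end Action

end TensorTriangular

theorem proposition3p10
    {T : Type u} [Category.{v} T] [Preadditive T] [HasZeroObject T] [HasShift T ℤ]
    [∀ n : ℤ, (shiftFunctor T n).Additive] [Pretriangulated T] [IsTriangulated T]
    [MonoidalCategory T] [SymmetricCategory T] [TensorTriangular.TensorTriangulated T]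
    [TensorTriangular.RigidlyCompactlyGenerated T]
    [TopologicalSpace.NoetherianSpace (TensorTriangular.Spc T)]
    {K : Type u'} [Category.{v} K] [Preadditive K] [HasZeroObject K] [HasShift K ℤ]
    [∀ n : ℤ, (shiftFunctor K n).Additive] [Pretriangulated K] [IsTriangulated K]
    [TensorTriangular.CompactlyGenerated K]
    [MonoidalLeftAction T K] [TensorTriangular.TriangulatedAction T K]
    (hLTG : TensorTriangular.LocalToGlobal T K) :
    (∀ W : Set (TensorTriangular.Spc T),
      TensorTriangular.sigma (TensorTriangular.tau K W) =
        W ∩ TensorTriangular.sigma (TensorTriangular.wholeSubmodule T K)) ∧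
    Set.InjOn (TensorTriangular.tau K)
      {W : Set (TensorTriangular.Spc T) |
        W ⊆ TensorTriangular.sigma (TensorTriangular.wholeSubmodule T K)} ∧
    ∀ W : Set (TensorTriangular.Spc T),
      TensorTriangular.tau K W =
        TensorTriangular.locStar T
          (⨆ x ∈ W ∩ TensorTriangular.sigma (TensorTriangular.wholeSubmodule T K),
            TensorTriangular.gammaEssImage K x) := by
  refine ⟨TensorTriangular.sigma_tau, fun W hW W' hW' h => ?_, TensorTriangular.tau_eq_locStar hLTG⟩
  rw [← Set.inter_eq_left.2 hW, ← Set.inter_eq_left.2 hW', ← TensorTriangular.sigma_tau,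
    ← TensorTriangular.sigma_tau, h]
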